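/- **Theorem (Poincaré inequality).** Let $\Omega\subset\mathbb R^d$ be open and bounded, and let $\nu:\mathbb R^d\setminus\{0\}\to[0,\infty]$ be measurable, symmetric ($\nu(-h)=\nu(h)$), with $$\int_{\mathbb R^d}(1\wedge|h|^2)\,\nu(h)\,dh<\infty ,$$ and with full support, i.e. $\int_U\nu(h)\,dh>0$ for every non-empty open $U\subset\mathbb R^d$. For an open set $D\subset\mathbb R^d$ let $H_\nu(D)$ be the space of all $u\in L^2(D)$ with $$\|u\|_{H_\nu(D)}^2=\|u\|_{L^2(D)}^2+\iint_{D\times D}(u(x)-u(y))^2\,\nu(x-y)\,dx\,dy<\infty .$$ Assume that at least one of the following four conditions holds. * $(\mathscr A_0)$ $\nu$ is unimodal: it is radial, and there is $c\ge1$ with $\nu(x)\le c\,\nu(y)$ whenever $0<|y|\le|x|$. * $(\mathscr A_1)$ $\int_{\mathbb R^d}\nu(h)\,dh=\infty$, and there are a map $T:H_\nu(\Omega)\to H_\nu(\mathbb R^d)$ and $C'>0$ such that $(Tu)|_\Omega=u$ a.e. and $\|Tu\|_{H_\nu(\mathbb R^d)}\le C'\|u\|_{H_\nu(\Omega)}$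 for all $u\in H_\nu(\Omega)$. * $(\mathscr A_2)$ $\int_{\mathbb R^d}\nu(h)\,dh=\infty$, $\nu$ is radial, $\Omega$ has a Lipschitz boundary (near each boundary point and in suitable orthonormal coordinates, $\Omega$ is the set of points strictly above the graph of a Lipschitz function), and $$\frac1{\delta^2}\int_{B_\delta(0)}|h|^2\,\nu(h)\,dh\longrightarrow\infty\qquad(\delta\to0^+).$$ * $(\mathscr A_3)$ $\int_{\mathbb R^d}\nu(h)\,dh=\infty$, and, with $\Omega_\delta=\{x\in\Omega:\operatorname{dist}(x,\partial\Omega)>\delta\}$, $$\inf_{a\in\partial\Omega}\int_{\Omega_\delta}\nu(h-a)\,dh\longrightarrow\infty\qquad(\delta\to0^+).$$ Then there is a constant $C>0$, depending only on $d$, $\Omega$ and $\nu$, such that $$\Big\|u-\frac{1}{|\Omega|}\int_\Omega u\Big\|_{L^2(\Omega)}^2\le C\iint_{\Omega\times\Omega}(u(x)-u(y))^2\,\nu(x-y)\,dx\,dy\qquad\text{for all }u\in L^2(\Omega),$$ where the right-hand side may be $+\infty$ (and the mean is $0$ if $\Omega=\emptyset$), and such that $$\Big\|u-\frac{1}{|\Omega|}\int_\Omega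 u\Big\|_{L^2(\Omega)}^2\le C\,\mathcal E(u,u)\qquad\text{for all }u\in V_\nu(\Omega|\mathbb R^d).$$ Here $$\mathcal E(u,u)=\frac12\iint_{(\Omega^c\times\Omega^c)^c}(u(x)-u(y))^2\,\nu(x-y)\,dx\,dy ,$$ and $V_\nu(\Omega|\mathbb R^d)$ is the space of all measurable $u:\mathbb R^d\to\mathbb R$ with $u|_\Omega\in L^2(\Omega)$ and $\iint_{\Omega\times\mathbb R^d}(u(x)-u(y))^2\,\nu(x-y)\,dx\,dy<\infty$. -/

import Mathlib

open MeasureTheory Filter Topology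
open scoped ENNReal NNReal

namespace NonlocalPoincare

/-- Euclidean space of dimension `d`. -/
abbrev Eucl (d : ℕ) : Type := EuclideanSpace ℝ (Fin d)

variable {d : ℕ}

/-! Densities are total functions `ν : ℝ^d → [0,∞]`. Every condition below ignores the value at the
origin (which is a Lebesgue null set). `AEMeasurable` with respect to `volume` is
Lebesgue measurability. -/

/-- `ν` is the density of a symmetric Lévy measure:
`ν(h) = ν(-h)` and `∫ (1 ∧ |h|²) ν(h) dh < ∞`. -/
structure IsLevyDensity (ν : Eucl d → ℝ≥0∞) : Prop where
  aemeasurable : AEMeasurable ν volume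
  symm : ∀ h, h ≠ 0 → ν (-h) = ν h
  lintegral_lt_top : ∫⁻ h, ENNReal.ofReal (min 1 (‖h‖ ^ 2)) * ν h < ∞

/-- The measure `ν(h) dh` has full (topological) support. -/
def HasFullSupport (ν : Eucl d → ℝ≥0∞) : Prop :=
  ((volume : Measure (Eucl d)).withDensity ν).support = Set.univ

/-- `ν` is a radial function on `ℝ^d \ {0}`. -/
def IsRadial (ν : Eucl d → ℝ≥0∞) : Prop :=
  ∀ x y : Eucl d, x ≠ 0 → y ≠ 0 → ‖x‖ = ‖y‖ → ν x = ν y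

/-- `ν` is radial with an almost decreasing profile: there is `c ≥ 1` with
`ν(r) ≤ c ν(s)` whenever `0 < s ≤ r`. -/
def IsUnimodal (ν : Eucl d → ℝ≥0∞) : Prop :=
  IsRadial ν ∧ ∃ c : ℝ≥0, 1 ≤ c ∧
    ∀ x y : Eucl d, x ≠ 0 → y ≠ 0 → ‖y‖ ≤ ‖x‖ → ν x ≤ c * ν y

/-- The energy `∬_S (u(x) - u(y))² ν(x - y) dx dy` over a set `S ⊆ ℝ^d × ℝ^d`. -/
noncomputable def energyOn (ν : Eucl d → ℝ≥0∞) (S : Set (Eucl d × Eucl d)) (u : Eucl d → ℝ) :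
    ℝ≥0∞ :=
  ∫⁻ p in S, ENNReal.ofReal ((u p.1 - u p.2) ^ 2) * ν (p.1 - p.2)

/-- `𝓔_Ω(u,u)`, the energy over `Ω × Ω`. -/
noncomputable def innerEnergy (ν : Eucl d → ℝ≥0∞) (Ω : Set (Eucl d)) (u : Eucl d → ℝ) : ℝ≥0∞ :=
  energyOn ν (Ω ×ˢ Ω) u

/-- `𝓔(u,u)`, one half of the energy over `(Ωᶜ × Ωᶜ)ᶜ`. -/
noncomputable def energy (ν : Eucl d → ℝ≥0∞) (Ω : Set (Eucl d)) (u : Eucl d → ℝ) : ℝ≥0∞ :=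
  2⁻¹ * energyOn ν (Ωᶜ ×ˢ Ωᶜ)ᶜ u

/-- `u|_Ω` belongs to `H_ν(Ω)`. The values of `u` outside `Ω` play no role. -/
def MemH (ν : Eucl d → ℝ≥0∞) (Ω : Set (Eucl d)) (u : Eucl d → ℝ) : Prop :=
  MemLp u 2 (volume.restrict Ω) ∧ innerEnergy ν Ω u < ∞

/-- The norm of `H_ν(Ω)`: `‖u‖² = ‖u‖²_{L²(Ω)} + 𝓔_Ω(u,u)`. -/
noncomputable def normH (ν : Eucl d → ℝ≥0∞) (Ω : Set (Eucl d)) (u : Eucl d → ℝ) : ℝ≥0∞ :=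
  (eLpNorm u 2 (volume.restrict Ω) ^ 2 + innerEnergy ν Ω u) ^ (1 / 2 : ℝ)

/-- `u` belongs to `V_ν(Ω|ℝ^d)`: `u` is measurable on `ℝ^d`, `u|_Ω ∈ L²(Ω)` and
`∬_{Ω × ℝ^d} (u(x) - u(y))² ν(x - y) dx dy < ∞`. -/
structure MemV (ν : Eucl d → ℝ≥0∞) (Ω : Set (Eucl d)) (u : Eucl d → ℝ) : Prop where
  aemeasurable : AEMeasurable u volume
  memLp : MemLp u 2 (volume.restrict Ω)
  seminorm_lt_top : energyOn ν (Ω ×ˢ Set.univ) u < ∞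

/-- `Ω` has a Lipschitz boundary: near every boundary point, and in suitable orthonormal
coordinates, `Ω` is the region strictly above the graph of a Lipschitz function. Here the unit
vector `e` is the vertical direction and `x - ⟪e, x⟫ e` is the horizontal part of `x`. -/
def HasLipschitzBoundary (Ω : Set (Eucl d)) : Prop :=
  ∀ a ∈ frontier Ω, ∃ r : ℝ, 0 < r ∧ ∃ e : Eucl d, ‖e‖ = 1 ∧
    ∃ (γ : Eucl d → ℝ) (K : ℝ≥0), LipschitzWith K γ ∧
      ∀ x ∈ Metric.ball a r, x ∈ Ω ↔ γ (x - inner ℝ e x • e) < inner ℝ e x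

/-- `q(δ) = δ⁻² ∫_{B_δ(0)} |h|² ν(h) dh`. -/
noncomputable def q (ν : Eucl d → ℝ≥0∞) (δ : ℝ) : ℝ≥0∞ :=
  ENNReal.ofReal (1 / δ ^ 2) * ∫⁻ h in Metric.ball 0 δ, ENNReal.ofReal (‖h‖ ^ 2) * ν h

/-- `Ω_δ = {x ∈ Ω : dist(x, ∂Ω) > δ}`. -/
def innerSet (Ω : Set (Eucl d)) (δ : ℝ) : Set (Eucl d) :=
  {x ∈ Ω | ENNReal.ofReal δ < Metric.infEDist x (frontier Ω)}

/-- `q̃(δ) = inf_{a ∈ ∂Ω} ∫_{Ω_δ} ν(h - a) dh`. -/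
noncomputable def qTilde (ν : Eucl d → ℝ≥0∞) (Ω : Set (Eucl d)) (δ : ℝ) : ℝ≥0∞ :=
  ⨅ a ∈ frontier Ω, ∫⁻ h in innerSet Ω δ, ν (h - a)

/-- The class `𝒜₀`. -/
structure ClassA0 (ν : Eucl d → ℝ≥0∞) (Ω : Set (Eucl d)) : Prop where
  isOpen : IsOpen Ω
  isBounded : Bornology.IsBounded Ω
  levy : IsLevyDensity ν
  unimodal : IsUnimodal ν
  fullSupport : HasFullSupport ν

/-- The requirements common to the classes `𝒜₁`, `𝒜₂`, `𝒜₃`: `Ω` is open and bounded, and `ν` is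
a Lévy density which is not integrable. -/
structure ClassABase (ν : Eucl d → ℝ≥0∞) (Ω : Set (Eucl d)) : Prop where
  isOpen : IsOpen Ω
  isBounded : Bornology.IsBounded Ω
  levy : IsLevyDensity ν
  lintegral_eq_top : ∫⁻ h, ν h = ∞

/-- The class `𝒜₁`: there is a bounded extension operator `T : H_ν(Ω) → H_ν(ℝ^d)`. -/
structure ClassA1 (ν : Eucl d → ℝ≥0∞) (Ω : Set (Eucl d)) : Prop extends ClassABase ν Ω where
  extension : ∃ (T : (Eucl d → ℝ) → (Eucl d → ℝ)) (C : ℝ≥0), 0 < C ∧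
    ∀ u : Eucl d → ℝ, MemH ν Ω u →
      MemH ν Set.univ (T u) ∧ T u =ᵐ[volume.restrict Ω] u ∧
        normH ν Set.univ (T u) ≤ C * normH ν Ω u

/-- The class `𝒜₂`: Lipschitz boundary, `ν` radial and `q(δ) → ∞` as `δ → 0+`. -/
structure ClassA2 (ν : Eucl d → ℝ≥0∞) (Ω : Set (Eucl d)) : Prop extends ClassABase ν Ω where
  lipschitz : HasLipschitzBoundary Ω
  radial : IsRadial ν
  tendsto_q : Tendsto (q ν) (𝓝[>] 0) (𝓝 ∞)

/-- The class `𝒜₃`: `q̃(δ) → ∞` as `δ → 0+`. -/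
structure ClassA3 (ν : Eucl d → ℝ≥0∞) (Ω : Set (Eucl d)) : Prop extends ClassABase ν Ω where
  tendsto_qTilde : Tendsto (qTilde ν Ω) (𝓝[>] 0) (𝓝 ∞)

end NonlocalPoincare

namespace NonlocalPoincare

open scoped Pointwise

variable {d : ℕ}

/-! The variance of `u` is at most `|Ω|⁻¹` times the unweighted double integral of `(u(x) - u(y))²`
(Jensen), so it suffices to bound that integral by the energy. Openness and boundedness of `Ω` and
full support of `ν` are enough for this.

Near the diagonal at `a ∈ closure Ω`, `x` and `y` need not see each other through `ν`, but they see
common points. By full support, `ν (a - ·) ≥ ε` on a compact `K ⊆ Ω` of positive measure; for `x`,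
`y` close to `a` the translates of `K` by `x - a` and `y - a` stay in `Ω` and overlap in at least
half of `|K|`. Averaging over `z` in the overlap controls the increment (`controls_near_diagonal`).
Since `K` lies inside `Ω`, boundary points need no regularity.

Two such neighbourhoods, however far apart, are joined by chains `x → z → w → y` whose middle jump
is paid for by `ν` (`Controls.link`). Compactness of `closure Ω ×ˢ closure Ω` then gives the global
bound (`controls_closure`). -/

/-- The squared increment `(u(x) - u(y))²` as an extended nonnegative real. -/
noncomputable def sqDiff {X : Type*} (u : X → ℝ) (x y : X) : ℝ≥0∞ :=
  ENNReal.ofReal ((u x - u y) ^ 2)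

/-! ### Increments along chains of points -/

lemma sqDiff_le_two {X : Type*} (u : X → ℝ) (x y z : X) :
    sqDiff u x y ≤ 2 * (sqDiff u x z + sqDiff u y z) := by
  unfold sqDiff
  rw [← ENNReal.ofReal_add (by positivity) (by positivity),
    show (2 : ℝ≥0∞) = ENNReal.ofReal 2 by simp, ← ENNReal.ofReal_mul (by norm_num)]
  apply ENNReal.ofReal_le_ofReal
  nlinarith [sq_nonneg (u x - u z + (u y - u z))]

lemma sqDiff_le_three {X : Type*} (u : X → ℝ) (x y z w : X) :
    sqDiff u x y ≤ 3 * (sqDiff u x z + sqDiff u z w + sqDiff u y w) := by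
  unfold sqDiff
  rw [← ENNReal.ofReal_add (by positivity) (by positivity),
    ← ENNReal.ofReal_add (by positivity) (by positivity),
    show (3 : ℝ≥0∞) = ENNReal.ofReal 3 by simp, ← ENNReal.ofReal_mul (by norm_num)]
  apply ENNReal.ofReal_le_ofReal
  nlinarith [sq_nonneg ((u x - u z) - (u z - u w)), sq_nonneg ((u x - u z) + (u y - u w)),
    sq_nonneg ((u z - u w) + (u y - u w))]

@[fun_prop]
lemma measurable_sqDiff {X Y : Type*} [MeasurableSpace X] [MeasurableSpace Y] {u : X → ℝ}
    (hu : Measurable u) {f g : Y → X} (hf : Measurable f) (hg : Measurable g) :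
    Measurable fun p => sqDiff u (f p) (g p) := by
  unfold sqDiff
  fun_prop

/-- The energy over `Ω × Ω` as an iterated integral. -/
noncomputable def iterEnergy (ν : Eucl d → ℝ≥0∞) (Ω : Set (Eucl d)) (u : Eucl d → ℝ) : ℝ≥0∞ :=
  ∫⁻ x in Ω, ∫⁻ y in Ω, sqDiff u x y * ν (x - y)

/-- The energy controls the unweighted double integral of `(u(x) - u(y))²` over
`(A ∩ Ω) × (B ∩ Ω)`. -/
def Controls (ν : Eucl d → ℝ≥0∞) (Ω : Set (Eucl d)) (A B : Set (Eucl d)) : Prop :=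
  ∃ C : ℝ≥0∞, C ≠ ∞ ∧ ∀ u : Eucl d → ℝ, Measurable u →
    ∫⁻ x in A ∩ Ω, ∫⁻ y in B ∩ Ω, sqDiff u x y ≤ C * iterEnergy ν Ω u

/-! ### Full support and translates of compact sets -/

lemma HasFullSupport.lintegral_pos {ν : Eucl d → ℝ≥0∞}
    (hs : HasFullSupport ν) {U : Set (Eucl d)} (hU : IsOpen U) (hne : U.Nonempty) (a : Eucl d) :
    0 < ∫⁻ z in U, ν (a - z) := by
  obtain ⟨x, hx⟩ := hne
  have hV : IsOpen ((fun z => a - z) ⁻¹' U) := hU.preimage (by fun_prop)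
  have h1 : a - x ∈ ((volume : Measure (Eucl d)).withDensity ν).support := by
    rw [hs]; trivial
  have h2 := (Measure.mem_support_iff_forall _).1 h1 _ (hV.mem_nhds (by simpa using hx))
  rw [withDensity_apply _ hV.measurableSet] at h2
  refine h2.trans_eq ?_
  rw [← lintegral_indicator hU.measurableSet, ← lintegral_indicator hV.measurableSet,
    ← lintegral_sub_left_eq_self _ a]
  congr 1
  ext z
  by_cases hz : z ∈ U <;> simp [Set.indicator, hz]

/-- Translating a compact set slightly moves little mass out of it. Applied to the shift `s - t`,
this leaves less than half of `s +ᵥ K` outside `t +ᵥ K`. -/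
lemma exists_compact_shift {K : Set (Eucl d)} (hK : IsCompact K) (hpos : volume K ≠ 0) :
    ∃ V ∈ 𝓝 (0 : Eucl d), ∀ s ∈ V, ∀ t ∈ V,
      volume K / 2 ≤ volume ((s +ᵥ K) ∩ (t +ᵥ K)) := by
  have h1 := tendsto_measure_vadd_sdiff_isCompact_isClosed (μ := (volume : Measure (Eucl d)))
    hK hK.isClosed
  have h2 : ∀ᶠ g in 𝓝 (0 : Eucl d), volume ((g +ᵥ K) \ K) < volume K / 2 :=
    h1.eventually (gt_mem_nhds (ENNReal.half_pos hpos))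
  have h3 : Tendsto (fun p : Eucl d × Eucl d => p.1 - p.2) (𝓝 0 ×ˢ 𝓝 0) (𝓝 0) := by
    have : Continuous fun p : Eucl d × Eucl d => p.1 - p.2 := by fun_prop
    simpa [nhds_prod_eq] using this.tendsto (0, 0)
  obtain ⟨V, hV, hVV⟩ := mem_prod_same_iff.1 (h3.eventually h2)
  refine ⟨V, hV, fun s hs t ht => ?_⟩
  have h4 : volume (((s - t) +ᵥ K) \ K) < volume K / 2 := hVV (Set.mk_mem_prod hs ht)
  have h5 : (s +ᵥ K) \ (t +ᵥ K) = t +ᵥ (((s - t) +ᵥ K) \ K) := by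
    rw [Set.vadd_set_sdiff, vadd_vadd, add_sub_cancel]
  have h6 : volume ((s +ᵥ K) \ (t +ᵥ K)) < volume K / 2 := by
    rw [h5, measure_vadd]; exact h4
  have hm : MeasurableSet (t +ᵥ K) := (hK.vadd t).measurableSet
  have h7 := measure_inter_add_sdiff (μ := volume) (s +ᵥ K) hm
  rw [measure_vadd] at h7
  by_contra! hlt
  have := ENNReal.add_lt_add hlt h6
  rw [h7, ENNReal.add_halves] at this
  exact lt_irrefl _ this

lemma exists_compact_shift_subset {K Ω : Set (Eucl d)} (hK : IsCompact K) (hΩ : IsOpen Ω)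
    (h : K ⊆ Ω) : ∃ V ∈ 𝓝 (0 : Eucl d), ∀ s ∈ V, s +ᵥ K ⊆ Ω := by
  obtain ⟨V, hV, h'⟩ := compact_open_separated_add_left hK hΩ h
  refine ⟨V, hV, fun s hs => ?_⟩
  rintro _ ⟨k, hk, rfl⟩
  exact h' (Set.add_mem_add hs hk)

/-! ### Local control through common intermediate points -/

lemma controls_near_diagonal {ν : Eucl d → ℝ≥0∞} (hν : Measurable ν) (hs : HasFullSupport ν)
    {Ω : Set (Eucl d)} (hΩ : IsOpen Ω) (hne : Ω.Nonempty) (hfin : volume Ω ≠ ∞) (a : Eucl d) :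
    ∃ U, IsOpen U ∧ a ∈ U ∧ Controls ν Ω U U := by
  have hνa : Measurable fun z => ν (a - z) := by fun_prop
  -- a level set of `ν (a - ·)` with positive measure
  obtain ⟨ε, hε, hpos⟩ : ∃ ε : ℝ≥0∞, ε ≠ 0 ∧ 0 < volume ({z | ε ≤ ν (a - z)} ∩ Ω) := by
    have h0 := hs.lintegral_pos hΩ hne a
    by_contra! hcon
    have h1 : ∀ᵐ z ∂(volume.restrict Ω), ∀ n : ℕ, ν (a - z) < (n + 1 : ℝ≥0∞)⁻¹ := by
      rw [ae_all_iff]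
      intro n
      have := hcon ((n + 1 : ℝ≥0∞)⁻¹) (by simp)
      rw [ae_iff, Measure.restrict_apply (by measurability)]
      simpa using this
    have h2 : ∫⁻ z in Ω, ν (a - z) = 0 := by
      rw [lintegral_eq_zero_iff hνa]
      filter_upwards [h1] with z hz
      by_contra hz0
      obtain ⟨n, hn⟩ := ENNReal.exists_inv_nat_lt hz0
      refine absurd (hz n) (not_lt.2 (le_trans ?_ hn.le))
      gcongr
      simp
    exact h0.ne' h2
  have hmeas : MeasurableSet ({z | ε ≤ ν (a - z)} ∩ Ω) :=
    (measurableSet_le measurable_const hνa).inter hΩ.measurableSet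
  obtain ⟨K, hKs, hK, hKpos⟩ := hmeas.exists_lt_isCompact hpos
  obtain ⟨V₁, hV₁, h₁⟩ := exists_compact_shift hK hKpos.ne'
  obtain ⟨V₂, hV₂, h₂⟩ := exists_compact_shift_subset hK hΩ (hKs.trans Set.inter_subset_right)
  obtain ⟨V, hVs, hVo, hV0⟩ := mem_nhds_iff.1 (inter_mem hV₁ hV₂)
  set κ := volume K / 2 with hκ
  have hκ0 : κ ≠ 0 := (ENNReal.half_pos hKpos.ne').ne'
  have hκt : κ ≠ ∞ := ENNReal.div_ne_top hK.measure_lt_top.ne (by simp)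
  -- `ε` may be infinite, so it is replaced by `min ε 1`
  set η := min ε 1 with hη
  have hη0 : η ≠ 0 := by simp [hη, hε]
  have hηt : η ≠ ∞ := ne_top_of_le_ne_top ENNReal.one_ne_top (min_le_right _ _)
  refine ⟨(fun y => y - a) ⁻¹' V, hVo.preimage (by fun_prop), by simpa using hV0,
    (η * κ)⁻¹ * (2 * (2 * volume Ω)),
    ENNReal.mul_ne_top (by simp [hη0, hκ0]) (by finiteness), fun u hu => ?_⟩
  set U := (fun y => y - a) ⁻¹' V
  set F : Eucl d → ℝ≥0∞ := fun y => ∫⁻ z in Ω, sqDiff u y z * ν (y - z) with hF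
  have hFm : Measurable F := by
    have : Measurable fun p : Eucl d × Eucl d => sqDiff u p.1 p.2 * ν (p.1 - p.2) := by fun_prop
    exact this.lintegral_prod_right'
  have key : ∀ x ∈ U, ∀ y ∈ U, sqDiff u x y ≤ (η * κ)⁻¹ * (2 * (F x + F y)) := by
    intro x hx y hy
    have hηκ0 : η * κ ≠ 0 := mul_ne_zero hη0 hκ0
    have hηκt : η * κ ≠ ∞ := ENNReal.mul_ne_top hηt hκt
    rw [mul_comm, ← div_eq_mul_inv, ENNReal.le_div_iff_mul_le (.inl hηκ0) (.inl hηκt)]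
    set Z := ((x - a) +ᵥ K) ∩ ((y - a) +ᵥ K) with hZ
    have hZm : MeasurableSet Z := (hK.vadd _).measurableSet.inter (hK.vadd _).measurableSet
    have hZΩ : Z ⊆ Ω := Set.inter_subset_left.trans (h₂ _ (hVs hx).2)
    -- If `z = (w - a) + k` then `w - z = a - k`: the lower bound on `K` travels with the translate.
    have hZν : ∀ w, ∀ z ∈ (w - a) +ᵥ K, η ≤ ν (w - z) := by
      rintro w _ ⟨k, hk, rfl⟩
      have : ε ≤ ν (a - k) := (hKs hk).1
      refine (min_le_left _ _).trans (this.trans_eq ?_)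
      congr 1
      simp only [vadd_eq_add]
      abel
    calc sqDiff u x y * (η * κ) ≤ sqDiff u x y * (η * volume Z) := by
          gcongr; exact h₁ _ (hVs hx).1 _ (hVs hy).1
      _ = ∫⁻ z in Z, sqDiff u x y * η := by rw [setLIntegral_const, mul_assoc]
      _ ≤ ∫⁻ z in Z, 2 * (sqDiff u x z * ν (x - z) + sqDiff u y z * ν (y - z)) := by
          refine setLIntegral_mono' hZm fun z hz => ?_
          calc sqDiff u x y * η ≤ 2 * (sqDiff u x z + sqDiff u y z) * η := by
                gcongr; exact sqDiff_le_two u x y z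
            _ = 2 * (sqDiff u x z * η + sqDiff u y z * η) := by ring
            _ ≤ _ := by
                gcongr
                · exact hZν x z hz.1
                · exact hZν y z hz.2
      _ ≤ ∫⁻ z in Ω, 2 * (sqDiff u x z * ν (x - z) + sqDiff u y z * ν (y - z)) :=
          lintegral_mono_set hZΩ
      _ = 2 * (F x + F y) := by
          rw [lintegral_const_mul _ (by fun_prop), lintegral_add_left (by fun_prop)]
  have hUm : MeasurableSet (U ∩ Ω) :=
    (hVo.preimage (by fun_prop : Continuous fun y => y - a)).measurableSet.inter hΩ.measurableSet
  calc ∫⁻ x in U ∩ Ω, ∫⁻ y in U ∩ Ω, sqDiff u x y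
      ≤ ∫⁻ x in U ∩ Ω, ∫⁻ y in U ∩ Ω, (η * κ)⁻¹ * (2 * (F x + F y)) :=
        setLIntegral_mono' hUm fun x hx => setLIntegral_mono' hUm fun y hy => key x hx.1 y hy.1
    _ ≤ ∫⁻ x in Ω, ∫⁻ y in Ω, (η * κ)⁻¹ * (2 * (F x + F y)) :=
        (lintegral_mono_set Set.inter_subset_right).trans
          (lintegral_mono fun x => lintegral_mono_set Set.inter_subset_right)
    _ = ∫⁻ x in Ω, (η * κ)⁻¹ * (2 * (F x * volume Ω + iterEnergy ν Ω u)) := by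
        congr 1 with x
        rw [lintegral_const_mul _ (by fun_prop), lintegral_const_mul _ (by fun_prop),
          lintegral_add_left (by fun_prop), setLIntegral_const]
        rfl
    _ = (η * κ)⁻¹ * (2 * (2 * volume Ω)) * iterEnergy ν Ω u := by
        rw [lintegral_const_mul _ (by fun_prop), lintegral_const_mul _ (by fun_prop),
          lintegral_add_left (by fun_prop), setLIntegral_const,
          lintegral_mul_const _ (by fun_prop)]
        change (η * κ)⁻¹ * (2 * (iterEnergy ν Ω u * volume Ω + iterEnergy ν Ω u * volume Ω)) = _
        ring

/-! ### Linking distant regions -/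

/-- Two regions in which the energy controls the increments are linked by the kernel. -/
lemma Controls.link {ν : Eucl d → ℝ≥0∞} (hν : Measurable ν) (hs : HasFullSupport ν)
    {Ω A B : Set (Eucl d)} (hΩ : IsOpen Ω) (hfin : volume Ω ≠ ∞) (hA : IsOpen A) (hB : IsOpen B)
    (hAne : (A ∩ Ω).Nonempty) (hBne : (B ∩ Ω).Nonempty) (hAA : Controls ν Ω A A)
    (hBB : Controls ν Ω B B) : Controls ν Ω A B := by
  obtain ⟨C₁, hC₁, h₁⟩ := hAA
  obtain ⟨C₂, hC₂, h₂⟩ := hBB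
  set A' := A ∩ Ω
  set B' := B ∩ Ω
  have hA' : IsOpen A' := hA.inter hΩ
  have hB' : IsOpen B' := hB.inter hΩ
  have hAf : volume A' ≠ ∞ := measure_ne_top_of_subset Set.inter_subset_right hfin
  have hBf : volume B' ≠ ∞ := measure_ne_top_of_subset Set.inter_subset_right hfin
  -- Truncating at `1` makes the total weight `β` finite and lets the weight be dropped from the
  -- outer links `x → z` and `w → y`; only the middle link needs `ν`.
  set J : Eucl d → ℝ≥0∞ := fun h => min (ν h) 1
  have hJ : Measurable J := by fun_prop
  have hJ1 : ∀ h, J h ≤ 1 := fun h => min_le_right _ _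
  have hJν : ∀ h, J h ≤ ν h := fun h => min_le_left _ _
  set β := ∫⁻ z in A', ∫⁻ w in B', J (z - w) with hβ
  have hin : Measurable fun z => ∫⁻ w in B', J (z - w) := by
    have : Measurable fun p : Eucl d × Eucl d => J (p.1 - p.2) := by fun_prop
    exact this.lintegral_prod_right'
  have hβ0 : β ≠ 0 := by
    intro h0
    rw [hβ, lintegral_eq_zero_iff hin] at h0
    have hne : (ae (volume.restrict A')).NeBot := by
      rw [ae_neBot, Ne, Measure.restrict_eq_zero]
      exact (hA'.measure_pos _ hAne).ne'
    obtain ⟨z, hz⟩ := h0.exists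
    have hz' : ∫⁻ w in B', J (z - w) = 0 := hz
    rw [lintegral_eq_zero_iff (by fun_prop)] at hz'
    refine (hs.lintegral_pos hB' hBne z).ne' ?_
    rw [lintegral_eq_zero_iff (by fun_prop)]
    filter_upwards [hz'] with w hw
    simpa [J] using hw
  have hβt : β ≠ ∞ := by
    refine ne_top_of_le_ne_top (ENNReal.mul_ne_top hBf hAf) ?_
    calc β ≤ ∫⁻ z in A', ∫⁻ w in B', 1 :=
          lintegral_mono fun z => lintegral_mono fun w => hJ1 _
      _ = volume B' * volume A' := by simp
  refine ⟨β⁻¹ * (3 * (volume B' * (volume B' * C₁) + volume A' * volume B'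
      + volume A' * (volume A' * C₂))), ENNReal.mul_ne_top (by simp [hβ0]) (by finiteness),
    fun u hu => ?_⟩
  set E := iterEnergy ν Ω u
  set G : Eucl d → ℝ≥0∞ := fun x => ∫⁻ z in A', sqDiff u x z with hG
  set H : Eucl d → ℝ≥0∞ := fun y => ∫⁻ w in B', sqDiff u y w with hH
  have hsq : Measurable fun p : Eucl d × Eucl d => sqDiff u p.1 p.2 := by fun_prop
  have hGm : Measurable G := hsq.lintegral_prod_right'
  have hHm : Measurable H := hsq.lintegral_prod_right'
  have hlink : ∫⁻ z in A', ∫⁻ w in B', sqDiff u z w * ν (z - w) ≤ E :=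
    (lintegral_mono_set Set.inter_subset_right).trans
      (lintegral_mono fun x => lintegral_mono_set Set.inter_subset_right)
  have hlm : Measurable fun z => ∫⁻ w in B', sqDiff u z w * ν (z - w) := by
    have : Measurable fun p : Eucl d × Eucl d => sqDiff u p.1 p.2 * ν (p.1 - p.2) := by fun_prop
    exact this.lintegral_prod_right'
  have key : ∀ x y, sqDiff u x y ≤ β⁻¹ * (3 * (volume B' * G x + E + volume A' * H y)) := by
    intro x y
    rw [mul_comm, ← div_eq_mul_inv, ENNReal.le_div_iff_mul_le (.inl hβ0) (.inl hβt)]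
    calc sqDiff u x y * β = ∫⁻ z in A', ∫⁻ w in B', sqDiff u x y * J (z - w) := by
          rw [hβ, ← lintegral_const_mul _ hin]
          congr 1 with z
          rw [lintegral_const_mul _ (by fun_prop)]
      _ ≤ ∫⁻ z in A', ∫⁻ w in B',
            3 * (sqDiff u x z + sqDiff u z w * ν (z - w) + sqDiff u y w) := by
          refine lintegral_mono fun z => lintegral_mono fun w => ?_
          calc sqDiff u x y * J (z - w)
              ≤ 3 * (sqDiff u x z + sqDiff u z w + sqDiff u y w) * J (z - w) := by
                gcongr; exact sqDiff_le_three u x y z w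
            _ = 3 * (sqDiff u x z * J (z - w) + sqDiff u z w * J (z - w)
                  + sqDiff u y w * J (z - w)) := by ring
            _ ≤ _ := by
                gcongr
                · exact mul_le_of_le_one_right' (hJ1 _)
                · exact hJν _
                · exact mul_le_of_le_one_right' (hJ1 _)
      _ = ∫⁻ z in A', 3 * (sqDiff u x z * volume B'
            + (∫⁻ w in B', sqDiff u z w * ν (z - w)) + H y) := by
          congr 1 with z
          rw [lintegral_const_mul _ (by fun_prop), lintegral_add_left (by fun_prop),
            lintegral_add_left (by fun_prop), setLIntegral_const]
      _ = 3 * (G x * volume B' + (∫⁻ z in A', ∫⁻ w in B', sqDiff u z w * ν (z - w))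
            + H y * volume A') := by
          rw [lintegral_const_mul _ (by fun_prop), lintegral_add_left (by fun_prop),
            lintegral_add_left (by fun_prop), setLIntegral_const,
            lintegral_mul_const _ (by fun_prop)]
      _ ≤ 3 * (volume B' * G x + E + volume A' * H y) := by
          rw [mul_comm (G x), mul_comm (H y)]
          gcongr
  calc ∫⁻ x in A', ∫⁻ y in B', sqDiff u x y
      ≤ ∫⁻ x in A', ∫⁻ y in B', β⁻¹ * (3 * (volume B' * G x + E + volume A' * H y)) :=
        lintegral_mono fun x => lintegral_mono fun y => key x y
    _ = ∫⁻ x in A', β⁻¹ * (3 * ((volume B' * G x + E) * volume B'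
          + volume A' * ∫⁻ y in B', H y)) := by
        congr 1 with x
        rw [lintegral_const_mul _ (by fun_prop), lintegral_const_mul _ (by fun_prop),
          lintegral_add_left (by fun_prop), setLIntegral_const, lintegral_const_mul _ hHm]
    _ = β⁻¹ * (3 * ((volume B' * (∫⁻ x in A', G x) + E * volume A') * volume B'
          + volume A' * (∫⁻ y in B', H y) * volume A')) := by
        rw [lintegral_const_mul _ (by fun_prop), lintegral_const_mul _ (by fun_prop),
          lintegral_add_left (by fun_prop), setLIntegral_const,
          lintegral_mul_const _ (by fun_prop), lintegral_add_left (by fun_prop),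
          setLIntegral_const, lintegral_const_mul _ hGm]
    _ ≤ β⁻¹ * (3 * ((volume B' * (C₁ * E) + E * volume A') * volume B'
          + volume A' * (C₂ * E) * volume A')) := by
        gcongr
        · exact h₁ u hu
        · exact h₂ u hu
    _ = _ := by ring

/-! ### Globalisation by compactness -/

lemma controls_closure {ν : Eucl d → ℝ≥0∞} (hν : Measurable ν) (hs : HasFullSupport ν)
    {Ω : Set (Eucl d)} (hΩ : IsOpen Ω) (hb : Bornology.IsBounded Ω) (hne : Ω.Nonempty) :
    ∃ C : ℝ≥0∞, C ≠ ∞ ∧ ∀ u : Eucl d → ℝ, Measurable u →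
      ∫⁻ x in Ω, ∫⁻ y in Ω, sqDiff u x y ≤ C * iterEnergy ν Ω u := by
  have hfin : volume Ω ≠ ∞ := hb.measure_lt_top.ne
  have hcl : IsCompact (closure Ω) := hb.isCompact_closure
  have hpq : ∃ C : ℝ≥0∞, C ≠ ∞ ∧ ∀ u : Eucl d → ℝ, Measurable u →
      -- Control is monotone and subadditive in the set of pairs, so local control at every pair of
      -- points of the closure suffices.
      ∫⁻ p in (closure Ω ×ˢ closure Ω) ∩ Ω ×ˢ Ω, sqDiff u p.1 p.2 ≤ C * iterEnergy ν Ω u := by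
    refine (hcl.prod hcl).induction_on (p := fun S => ∃ C : ℝ≥0∞, C ≠ ∞ ∧
      ∀ u : Eucl d → ℝ, Measurable u →
        ∫⁻ p in S ∩ Ω ×ˢ Ω, sqDiff u p.1 p.2 ≤ C * iterEnergy ν Ω u) ?_ ?_ ?_ ?_
    · exact ⟨0, by simp, by simp⟩
    · rintro S T hST ⟨C, hC, h⟩
      exact ⟨C, hC, fun u hu => (lintegral_mono_set (by gcongr)).trans (h u hu)⟩
    · rintro S T ⟨C, hC, h⟩ ⟨C', hC', h'⟩
      refine ⟨C + C', by finiteness, fun u hu => ?_⟩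
      rw [Set.union_inter_distrib_right, add_mul]
      exact (lintegral_union_le _ _ _).trans (add_le_add (h u hu) (h' u hu))
    · rintro ⟨a, b⟩ ⟨ha, hb⟩
      obtain ⟨U, hU, haU, hUU⟩ := controls_near_diagonal hν hs hΩ hne hfin a
      obtain ⟨V, hV, hbV, hVV⟩ := controls_near_diagonal hν hs hΩ hne hfin b
      obtain ⟨C, hC, h⟩ := hUU.link hν hs hΩ hfin hU hV
        (mem_closure_iff.1 ha U hU haU) (mem_closure_iff.1 hb V hV hbV) hVV
      refine ⟨U ×ˢ V, mem_nhdsWithin_of_mem_nhds (prod_mem_nhds (hU.mem_nhds haU)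
        (hV.mem_nhds hbV)), C, hC, fun u hu => ?_⟩
      rw [Set.prod_inter_prod, Measure.volume_eq_prod, ← Measure.prod_restrict,
        lintegral_prod _ (by fun_prop)]
      exact h u hu
  obtain ⟨C, hC, h⟩ := hpq
  refine ⟨C, hC, fun u hu => ?_⟩
  have := h u hu
  rwa [Set.inter_eq_right.2 (Set.prod_mono subset_closure subset_closure),
    Measure.volume_eq_prod, ← Measure.prod_restrict, lintegral_prod _ (by fun_prop)] at this

/-! ### Variance and the Poincaré inequality -/

/-- The variance is bounded by the double integral of the squared increments. -/
lemma eLpNorm_sub_average_sq_le {X : Type*} [MeasurableSpace X] {μ : Measure X}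
    [IsFiniteMeasure μ] {u : X → ℝ} (hu : MemLp u 2 μ) :
    eLpNorm (fun x => u x - ⨍ y, u y ∂μ) 2 μ ^ 2
      ≤ (μ Set.univ)⁻¹ * ∫⁻ x, ∫⁻ y, sqDiff u x y ∂μ ∂μ := by
  rcases eq_zero_or_neZero μ with rfl | hμ
  · simp
  have hui : Integrable u μ := hu.integrable (by norm_num)
  have key : ∀ x, ‖u x - ⨍ y, u y ∂μ‖ₑ ^ 2 ≤ (μ Set.univ)⁻¹ * ∫⁻ y, sqDiff u x y ∂μ := by
    intro x
    have hL : MemLp (fun y => u x - u y) 2 μ := (memLp_const (u x)).sub hu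
    have hsq : Integrable (fun y => (u x - u y) ^ 2) μ := hL.integrable_sq
    -- Jensen for the square, with `x` fixed and the average taken in `y`.
    have hJ := (Even.convexOn_pow (𝕜 := ℝ) even_two).map_average_le (μ := μ)
      (continuous_pow 2).continuousOn isClosed_univ (by simp)
      (hL.integrable (by norm_num)) (by simpa [Function.comp_def] using hsq)
    have havg : ⨍ y, (u x - u y) ∂μ = u x - ⨍ y, u y ∂μ := by
      rw [average_eq, average_eq, integral_sub (integrable_const _) hui, smul_sub,
        integral_const, smul_smul, inv_mul_cancel₀ (by simp [measureReal_eq_zero_iff, hμ.out]),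
        one_smul]
    rw [havg] at hJ
    have h1 : ‖u x - ⨍ y, u y ∂μ‖ₑ ^ 2 = ENNReal.ofReal ((u x - ⨍ y, u y ∂μ) ^ 2) := by
      rw [← ofReal_norm, ← ENNReal.ofReal_pow (norm_nonneg _), Real.norm_eq_abs, sq_abs]
    rw [h1]
    refine (ENNReal.ofReal_le_ofReal hJ).trans_eq ?_
    have h2 : ∫⁻ y, sqDiff u x y ∂μ = ENNReal.ofReal (∫ y, (u x - u y) ^ 2 ∂μ) :=
      (ofReal_integral_eq_lintegral_ofReal hsq (ae_of_all _ fun _ => sq_nonneg _)).symm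
    rw [h2, average_eq, smul_eq_mul, ENNReal.ofReal_mul (by positivity),
      ENNReal.ofReal_inv_of_pos (by simp [measureReal_def, ENNReal.toReal_pos_iff, pos_iff_ne_zero,
        hμ.out, measure_lt_top])]
    congr 2
    simp
  rw [eLpNorm_eq_lintegral_rpow_enorm_toReal (by norm_num) (by norm_num)]
  simp only [ENNReal.toReal_ofNat, ENNReal.rpow_ofNat]
  rw [← ENNReal.rpow_two, ← ENNReal.rpow_mul]
  norm_num
  refine (lintegral_mono key).trans ?_
  rw [lintegral_const_mul' _ _ (by simp [hμ.out])]

/-- The Poincaré inequality for kernels of full support on bounded open sets. -/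
theorem poincare_of_hasFullSupport {d : ℕ} {Ω : Set (Eucl d)} {ν : Eucl d → ℝ≥0∞}
    (hΩ : IsOpen Ω) (hb : Bornology.IsBounded Ω)
    (hν : AEMeasurable ν volume) (hs : HasFullSupport ν) :
    ∃ C : ℝ≥0, 0 < C ∧ ∀ u : Eucl d → ℝ, MemLp u 2 (volume.restrict Ω) →
      eLpNorm (fun x => u x - ⨍ y in Ω, u y) 2 (volume.restrict Ω) ^ 2
        ≤ C * innerEnergy ν Ω u := by
  rcases Ω.eq_empty_or_nonempty with rfl | hne
  · exact ⟨1, one_pos, by simp⟩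
  have hfin : volume Ω ≠ ∞ := hb.measure_lt_top.ne
  have hpos : volume Ω ≠ 0 := (hΩ.measure_pos _ hne).ne'
  have : IsFiniteMeasure (volume.restrict Ω) := isFiniteMeasure_restrict.2 hfin
  -- Passing to Borel representatives of `ν` and of `u` on `Ω` changes neither side: subtraction and
  -- the projections pull null sets back to null sets.
  set ν' := hν.mk ν
  have hs' : HasFullSupport ν' := by
    unfold HasFullSupport at hs ⊢
    rwa [withDensity_congr_ae hν.ae_eq_mk.symm]
  obtain ⟨C, hC, h⟩ := controls_closure hν.measurable_mk hs' hΩ hb hne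
  have hC' : (volume Ω)⁻¹ * C ≠ ∞ := ENNReal.mul_ne_top (by simpa) hC
  refine ⟨((volume Ω)⁻¹ * C).toNNReal + 1, by positivity, fun u hu => ?_⟩
  obtain ⟨v, hv, huv⟩ := hu.aestronglyMeasurable.aemeasurable
  have hvL : MemLp v 2 (volume.restrict Ω) := (memLp_congr_ae huv).1 hu
  have havg : ⨍ y in Ω, u y = ⨍ y in Ω, v y := average_congr huv
  have hnorm : eLpNorm (fun x => u x - ⨍ y in Ω, u y) 2 (volume.restrict Ω)
      = eLpNorm (fun x => v x - ⨍ y in Ω, v y) 2 (volume.restrict Ω) := by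
    rw [havg]
    apply eLpNorm_congr_ae
    filter_upwards [huv] with x hx
    rw [hx]
  have hE : iterEnergy ν' Ω v = innerEnergy ν Ω u := by
    have hm := hν.measurable_mk
    unfold iterEnergy innerEnergy energyOn
    have hsub : (fun p : Eucl d × Eucl d => ν (p.1 - p.2))
        =ᵐ[volume] fun p => ν' (p.1 - p.2) :=
      (quasiMeasurePreserving_sub volume volume).ae_eq_comp hν.ae_eq_mk
    rw [← lintegral_prod (fun p : Eucl d × Eucl d => sqDiff v p.1 p.2 * ν' (p.1 - p.2))
      (by fun_prop), Measure.prod_restrict, ← Measure.volume_eq_prod]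
    apply lintegral_congr_ae
    have h1 : ∀ᵐ p ∂(volume : Measure (Eucl d × Eucl d)).restrict (Ω ×ˢ Ω), u p.1 = v p.1 := by
      rw [Measure.volume_eq_prod, ← Measure.prod_restrict]
      exact Measure.quasiMeasurePreserving_fst.ae huv
    have h2 : ∀ᵐ p ∂(volume : Measure (Eucl d × Eucl d)).restrict (Ω ×ˢ Ω), u p.2 = v p.2 := by
      rw [Measure.volume_eq_prod, ← Measure.prod_restrict]
      exact Measure.quasiMeasurePreserving_snd.ae huv
    filter_upwards [h1, h2, ae_restrict_of_ae hsub] with p hp1 hp2 hp3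
    rw [hp1, hp2, hp3, sqDiff]
  rw [hnorm, ← hE]
  calc eLpNorm (fun x => v x - ⨍ y in Ω, v y) 2 (volume.restrict Ω) ^ 2
      ≤ (volume Ω)⁻¹ * ∫⁻ x in Ω, ∫⁻ y in Ω, sqDiff v x y := by
        simpa using eLpNorm_sub_average_sq_le hvL
    _ ≤ (volume Ω)⁻¹ * (C * iterEnergy ν' Ω v) := by gcongr; exact h v hv
    _ ≤ _ := by
      rw [← mul_assoc, ENNReal.coe_add, ENNReal.coe_toNNReal hC']
      gcongr
      exact le_self_add

end NonlocalPoincare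

theorem mainTheorem4 {d : ℕ} (Ω : Set (EuclideanSpace ℝ (Fin d)))
    (ν : EuclideanSpace ℝ (Fin d) → ℝ≥0∞)
    (hΩ_open : IsOpen Ω) (hΩ_bdd : Bornology.IsBounded Ω)
    (hν_meas : AEMeasurable ν volume) (hν_supp : NonlocalPoincare.HasFullSupport ν)
    (hclass : NonlocalPoincare.ClassA0 ν Ω ∨ NonlocalPoincare.ClassA1 ν Ω ∨
      NonlocalPoincare.ClassA2 ν Ω ∨ NonlocalPoincare.ClassA3 ν Ω) :
    ∃ C : ℝ≥0, 0 < C ∧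
      (∀ u : EuclideanSpace ℝ (Fin d) → ℝ, MemLp u 2 (volume.restrict Ω) →
        eLpNorm (fun x => u x - ⨍ y in Ω, u y) 2 (volume.restrict Ω) ^ 2
          ≤ C * ∫⁻ p in Ω ×ˢ Ω, ENNReal.ofReal ((u p.1 - u p.2) ^ 2) * ν (p.1 - p.2)) ∧
      (∀ u : EuclideanSpace ℝ (Fin d) → ℝ, NonlocalPoincare.MemV ν Ω u →
        eLpNorm (fun x => u x - ⨍ y in Ω, u y) 2 (volume.restrict Ω) ^ 2
          ≤ C * NonlocalPoincare.energy ν Ω u) := by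
  obtain ⟨C, hC, h⟩ := NonlocalPoincare.poincare_of_hasFullSupport hΩ_open hΩ_bdd hν_meas hν_supp
  -- The factor `2` absorbs the `1/2` in `energy`, whose domain contains `Ω ×ˢ Ω`.
  refine ⟨2 * C, by positivity, fun u hu => (h u hu).trans ?_, fun u hu => (h u hu.memLp).trans ?_⟩
  · unfold NonlocalPoincare.innerEnergy NonlocalPoincare.energyOn
    gcongr
    exact le_mul_of_one_le_left' (by norm_num)
  · unfold NonlocalPoincare.energy NonlocalPoincare.innerEnergy
    rw [← mul_assoc, ENNReal.coe_mul, ENNReal.coe_ofNat, mul_right_comm 2 _ (2⁻¹ : ℝ≥0∞),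
      ENNReal.mul_inv_cancel (by norm_num) (by norm_num), one_mul]
    gcongr
    refine lintegral_mono_set fun p hp => ?_
    simp only [Set.mem_compl_iff, Set.mem_prod] at hp ⊢
    tauto
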